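/- Graphs are finite and may have parallel edges but no loops. A signature of a graph $G$ is a function $\sigma:E(G)\to\{\pm1\}$. Every edge $e=uv$ consists of two half-edges $h_e^u$ (at $u$) and $h_e^v$ (at $v$); for a half-edge $h$ let $e_h$ be its edge, and let $H(v)$ be the set of half-edges at $v$. An orientation of $(G,\sigma)$ is a map $\tau$ from the half-edges to $\{\pm1\}$ with $\tau(h_e^u)\tau(h_e^v)=-\sigma(e)$ for every edge $e=uv$. For real $r$, a nowhere-zero $r$-flow on $(G,\sigma)$ is an orientation $\tau$ together with a function $f:E(G)\to\mathbb{R}$ such that $1\le |f(e)|\le r-1$ for all $e\in E(G)$ and $\sum_{h\in H(v)}\tau(h)f(e_h)=0$ for all $v\in V(G)$; it is an integer flow if $f$ is integer-valued. $(G,\sigma)$ is flow-admissible if it has a nowhere-zero $r$-flow for some $r\ge 2$. Let $F_c((G,\sigma))$ be the infimum of all $r$ such that $(G,\sigma)$ has a nowhere-zero $r$-flow, and $F((G,\sigma))$ the infimum of all $r$ such that $(G,\sigma)$ has an integer nowhere-zero $r$-flow (each is $\infty$ if there is no such $r$). The flow spectrum ${\cal S}(G)$ is the set of all real numbers $F_c((G,\sigma))$,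 and the integer flow spectrum $\overline{{\cal S}}(G)$ the set of all real numbers $F((G,\sigma))$, where $\sigma$ ranges over the signatures of $G$ for which $(G,\sigma)$ is flow-admissible. Let $K_2^3$ be the graph with two vertices joined by three parallel edges. Theorem. Let $G$ be a cubic graph which has a connected component different from $K_2^3$ (for connected $G$ this says that $G\neq K_2^3$). Then the following statements are equivalent: 1) $G$ has a 1-factor; 2) $3\in{\cal S}(G)$; 3) $3\in\overline{{\cal S}}(G)$; 4) $4\in\overline{{\cal S}}(G)$. -/

import Mathlib

open scoped Graph

namespace SignedFlow

variable {α β : Type*}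

/-- A graph without loops is cubic if every vertex is incident with exactly three edges. -/
def IsCubic (G : Graph α β) : Prop :=
  ∀ v ∈ V(G), (G.incidenceSet v).ncard = 3

/-- A 1-factor: a spanning subgraph in which every vertex is incident with exactly one edge. -/
def HasOneFactor (G : Graph α β) : Prop :=
  ∃ F : Graph α β, F ≤s G ∧ ∀ v ∈ V(F), (F.incidenceSet v).ncard = 1

/-- `G` is (a copy of) `K₂³`: two vertices, connected by three parallel edges. -/
def IsK23 (G : Graph α β) : Prop :=
  ∃ x y : α, x ≠ y ∧ V(G) = {x, y} ∧ E(G).ncard = 3 ∧ ∀ e ∈ E(G), G.IsLink e x y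

/-- `C` is a connected component of `G`: a minimal nonempty closed subgraph. -/
def IsComponent (C G : Graph α β) : Prop :=
  Minimal (fun K : Graph α β ↦ K ≤c G ∧ V(K).Nonempty) C

/-- The set of negative edges of `G` under the signature `σ`.
Values of a signature outside `E(G)` are never used. -/
def negEdges (G : Graph α β) (σ : β → ℤˣ) : Set β :=
  {e ∈ E(G) | σ e = -1}

/-- Orientations of `(G, σ)`: `τ v e` is the sign of the half-edge of `e` at `v`
(so `1` means outgoing and `-1` incoming), and the two half-edges of an edge `e`
have signs with product `-σ e`. Values off the incident pairs are never used. -/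
def IsOrientation (G : Graph α β) (σ : β → ℤˣ) (τ : α → β → ℤˣ) : Prop :=
  ∀ ⦃e u v⦄, G.IsLink e u v → τ u e * τ v e = -σ e

/-- The boundary of `f` at `v`: the signed sum of `f` over the half-edges at `v`. -/
noncomputable def boundary (G : Graph α β) (τ : α → β → ℤˣ) (f : β → ℝ) (v : α) : ℝ :=
  ∑ᶠ e ∈ G.incidenceSet v, ((τ v e : ℤ) : ℝ) * f e

/-- `f` is an `r`-flow with respect to the orientation `τ`. -/
def IsFlow (G : Graph α β) (τ : α → β → ℤˣ) (r : ℝ) (f : β → ℝ) : Prop :=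
  (∀ e ∈ E(G), f e = 0 ∨ (1 ≤ |f e| ∧ |f e| ≤ r - 1)) ∧ ∀ v ∈ V(G), boundary G τ f v = 0

/-- `(G, σ)` admits a nowhere-zero `r`-flow. -/
def HasNZFlow (G : Graph α β) (σ : β → ℤˣ) (r : ℝ) : Prop :=
  ∃ τ, IsOrientation G σ τ ∧ ∃ f, IsFlow G τ r f ∧ ∀ e ∈ E(G), f e ≠ 0

/-- `(G, σ)` admits an integer-valued nowhere-zero `r`-flow. -/
def HasIntNZFlow (G : Graph α β) (σ : β → ℤˣ) (r : ℝ) : Prop :=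
  ∃ τ, IsOrientation G σ τ ∧ ∃ f, IsFlow G τ r f ∧ (∀ e ∈ E(G), f e ≠ 0) ∧
    ∀ e ∈ E(G), ∃ z : ℤ, f e = z

/-- `(G, σ)` is flow-admissible. -/
def FlowAdmissible (G : Graph α β) (σ : β → ℤˣ) : Prop :=
  ∃ r : ℝ, 2 ≤ r ∧ HasNZFlow G σ r

/-- The circular flow number `F_c((G, σ))`; it is `⊤` if there is no nowhere-zero flow. -/
noncomputable def circularFlowNumber (G : Graph α β) (σ : β → ℤˣ) : EReal :=
  ⨅ (r : ℝ) (_ : HasNZFlow G σ r), (r : EReal)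

/-- The integer flow number `F((G, σ))`; it is `⊤` if there is no integer nowhere-zero flow. -/
noncomputable def integerFlowNumber (G : Graph α β) (σ : β → ℤˣ) : EReal :=
  ⨅ (r : ℝ) (_ : HasIntNZFlow G σ r), (r : EReal)

/-- `Σ_X(G)`: the signatures with all negative edges in `X` that make `G` flow-admissible. -/
def admissibleSignatures (G : Graph α β) (X : Set β) : Set (β → ℤˣ) :=
  {σ | FlowAdmissible G σ ∧ negEdges G σ ⊆ X}

/-- The `X`-flow spectrum of `G`. -/
def flowSpectrumOn (G : Graph α β) (X : Set β) : Set ℝ :=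
  {r | ∃ σ ∈ admissibleSignatures G X, circularFlowNumber G σ = (r : EReal)}

/-- The integer `X`-flow spectrum of `G`. -/
def intFlowSpectrumOn (G : Graph α β) (X : Set β) : Set ℝ :=
  {r | ∃ σ ∈ admissibleSignatures G X, integerFlowNumber G σ = (r : EReal)}

/-- The flow spectrum of `G`. -/
def flowSpectrum (G : Graph α β) : Set ℝ := flowSpectrumOn G E(G)

/-- The integer flow spectrum of `G`. -/
def intFlowSpectrum (G : Graph α β) : Set ℝ := intFlowSpectrumOn G E(G)

end SignedFlow

namespace SignedFlow

variable {α β : Type*} {G C : Graph α β} {M : Set β}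


/-! At a cubic vertex three signed values sum to zero, so one modulus is the sum of the other two.
If `r < 4`, that modulus is at least 2 and the others are below 2: the large edges form a 1-factor.
For integer flows with `r < 5`, the even edges do. Conversely, the all-negative signature carries a
flow with value 2 on a 1-factor `M` and 1 elsewhere, and no cubic graph with a vertex does better
than 3.

The hard step is to find a signature with integer flow number exactly 4. For an edge `d = xy`
outside `M`, take values 2 on `M`, 3 on `d`, 1 elsewhere. The positive edges are then the
non-matching edges leaving `{x, y}`. A flow with `r < 4` forces antibalance
(`HasNZFlow.exists_switching`), so these edges form a cut; adding the cut of `{x, y}` shows that the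
matching edges leaving `{x, y}` form a cut too (`HasNZFlow.isEdgeCut_matchingBoundary`). If this
happened for every `d`, all matching edges of a suitable component would be bridges, which descent
excludes. Suitable means that some vertex has two distinct neighbours outside `M`; if necessary `M`
is first exchanged, which fails only for `K₂³`. -/

/-- Every vertex is incident with exactly one edge of `M`. -/
def IsPerfectMatching (G : Graph α β) (M : Set β) : Prop :=
  ∀ v ∈ V(G), ∃! e, e ∈ M ∧ G.Inc e v

/-! ### Perfect matchings and vertices of degree three -/

lemma hasOneFactor_of_isPerfectMatching (hM : IsPerfectMatching G M) : HasOneFactor G := by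
  refine ⟨G.restrict M, ⟨Graph.restrict_le, rfl⟩, fun v hv ↦ ?_⟩
  obtain ⟨e, he, hu⟩ := hM v hv
  refine Set.ncard_eq_one.2 ⟨e, Set.ext fun e' ↦ ?_⟩
  simp only [Graph.mem_incidenceSet, Graph.restrict_inc, Set.mem_singleton_iff]
  exact ⟨fun h ↦ hu e' ⟨h.2, h.1⟩, by rintro rfl; exact ⟨he.2, he.1⟩⟩

lemma HasOneFactor.exists_isPerfectMatching (h : HasOneFactor G) :
    ∃ M, IsPerfectMatching G M := by
  obtain ⟨F, hF, h1⟩ := h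
  refine ⟨E(F), fun v hv ↦ ?_⟩
  obtain ⟨e, he⟩ := Set.ncard_eq_one.1 (h1 v (hF.vertexSet_eq ▸ hv))
  have key : ∀ e', (e' ∈ E(F) ∧ G.Inc e' v) ↔ e' = e := fun e' ↦ by
    rw [← Set.mem_singleton_iff, ← he, Graph.mem_incidenceSet]
    exact ⟨fun h ↦ (hF.le.inc_congr h.1).2 h.2, fun h ↦ ⟨h.edge_mem, h.mono hF.le⟩⟩
  exact ⟨e, (key e).2 rfl, fun e' h ↦ (key e').1 h⟩

lemma IsCubic.exists_incidenceSet_eq (hG : IsCubic G) {v : α} (hv : v ∈ V(G)) :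
    ∃ a b c, a ≠ b ∧ a ≠ c ∧ b ≠ c ∧ G.incidenceSet v = {a, b, c} :=
  Set.ncard_eq_three.1 (hG v hv)

lemma IsPerfectMatching.exists_incidenceSet_eq (hM : IsPerfectMatching G M) (hG : IsCubic G)
    {v : α} (hv : v ∈ V(G)) :
    ∃ a b c, a ≠ b ∧ a ≠ c ∧ b ≠ c ∧ G.incidenceSet v = {a, b, c} ∧ a ∈ M ∧ b ∉ M ∧ c ∉ M := by
  obtain ⟨a, b, c, hab, hac, hbc, h⟩ := hG.exists_incidenceSet_eq hv
  have hinc : ∀ e, G.Inc e v ↔ e = a ∨ e = b ∨ e = c := fun e ↦ by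
    rw [← Graph.mem_incidenceSet, h]; simp
  obtain ⟨e, ⟨heM, hev⟩, hu⟩ := hM v hv
  have hu' : ∀ e', G.Inc e' v → e' ∈ M → e' = e := fun e' h1 h2 ↦ hu e' ⟨h2, h1⟩
  rcases (hinc e).1 hev with rfl | rfl | rfl
  · exact ⟨e, b, c, hab, hac, hbc, h, heM, fun hb ↦ hab (hu' b (by simp [hinc]) hb).symm,
      fun hc ↦ hac (hu' c (by simp [hinc]) hc).symm⟩
  · exact ⟨e, a, c, hab.symm, hbc, hac, by rw [h, Set.insert_comm], heM,
      fun hb ↦ hab (hu' a (by simp [hinc]) hb), fun hc ↦ hbc (hu' c (by simp [hinc]) hc).symm⟩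
  · refine ⟨e, a, b, hac.symm, hbc.symm, hab, ?_, heM,
      fun hb ↦ hac (hu' a (by simp [hinc]) hb), fun hc ↦ hbc (hu' b (by simp [hinc]) hc)⟩
    rw [h]; ext; simp; tauto

lemma existsUnique_of_incidenceSet_eq {v : α} {a b c : β} (h : G.incidenceSet v = {a, b, c})
    (hM : (a ∈ M ∧ b ∉ M ∧ c ∉ M) ∨ (b ∈ M ∧ a ∉ M ∧ c ∉ M) ∨ (c ∈ M ∧ a ∉ M ∧ b ∉ M)) :
    ∃! e, e ∈ M ∧ G.Inc e v := by
  have hinc : ∀ e, G.Inc e v ↔ e = a ∨ e = b ∨ e = c := fun e ↦ by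
    rw [← Graph.mem_incidenceSet, h]; simp
  simp only [hinc]
  rcases hM with k | k | k
  · exact ⟨a, by simp [k.1], by rintro e ⟨he, rfl | rfl | rfl⟩ <;> simp_all⟩
  · exact ⟨b, by simp [k.1], by rintro e ⟨he, rfl | rfl | rfl⟩ <;> simp_all⟩
  · exact ⟨c, by simp [k.1], by rintro e ⟨he, rfl | rfl | rfl⟩ <;> simp_all⟩

lemma boundary_eq_of_incidenceSet_eq {v : α} {a b c : β} (hab : a ≠ b) (hac : a ≠ c)
    (hbc : b ≠ c) (h : G.incidenceSet v = {a, b, c}) (τ : α → β → ℤˣ) (f : β → ℝ) :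
    boundary G τ f v =
      ((τ v a : ℤ) : ℝ) * f a + ((τ v b : ℤ) : ℝ) * f b + ((τ v c : ℤ) : ℝ) * f c := by
  classical
  have h' : G.incidenceSet v = (({a, b, c} : Finset β) : Set β) := by rw [h]; simp
  rw [boundary, h', finsum_mem_coe_finset, Finset.sum_insert (by simp [hab, hac]),
    Finset.sum_pair hbc, add_assoc]

/-- Every family of half-edge signs orients some signature. -/
lemma exists_isOrientation (G : Graph α β) (τ : α → β → ℤˣ) : ∃ σ, IsOrientation G σ τ := by
  have : ∀ e, ∃ s : ℤˣ, ∀ u v, G.IsLink e u v → τ u e * τ v e = -s := fun e ↦ by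
    by_cases h : ∃ u v, G.IsLink e u v
    · obtain ⟨u, v, huv⟩ := h
      refine ⟨-(τ u e * τ v e), fun u' v' h' ↦ ?_⟩
      obtain ⟨rfl, rfl⟩ | ⟨rfl, rfl⟩ := huv.eq_and_eq_or_eq_and_eq h'
      · rw [neg_neg]
      · rw [neg_neg, mul_comm]
    · exact ⟨1, fun u v huv ↦ absurd ⟨u, v, huv⟩ h⟩
  choose σ hσ using this
  exact ⟨σ, fun e u v h ↦ hσ e u v h⟩

/-! ### Consequences of a small flow value bound -/

section Flow

variable {σ : β → ℤˣ} {τ : α → β → ℤˣ} {f : β → ℝ} {r : ℝ}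

lemma abs_unit_mul (s : ℤˣ) (x : ℝ) : |((s : ℤ) : ℝ) * x| = |x| := by
  rcases Int.units_eq_one_or s with rfl | rfl <;> simp

/-- At a vertex of degree three of a nowhere-zero `r`-flow the three signed values sum to zero
and have absolute value in `[1, r - 1]`. -/
lemma IsFlow.exists_incidenceSet_eq (hf : IsFlow G τ r f) (hnz : ∀ e ∈ E(G), f e ≠ 0)
    (hG : IsCubic G) {v : α} (hv : v ∈ V(G)) :
    ∃ a b c, a ≠ b ∧ a ≠ c ∧ b ≠ c ∧ G.incidenceSet v = {a, b, c} ∧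
      ((τ v a : ℤ) : ℝ) * f a + ((τ v b : ℤ) : ℝ) * f b + ((τ v c : ℤ) : ℝ) * f c = 0 ∧
      ∀ e ∈ G.incidenceSet v, 1 ≤ |f e| ∧ |f e| ≤ r - 1 := by
  obtain ⟨a, b, c, hab, hac, hbc, h⟩ := hG.exists_incidenceSet_eq hv
  refine ⟨a, b, c, hab, hac, hbc, h, ?_, fun e he ↦ ?_⟩
  · rw [← boundary_eq_of_incidenceSet_eq hab hac hbc h, hf.2 v hv]
  · have heE := G.incidenceSet_subset_edgeSet v he
    exact (hf.1 e heE).resolve_left (hnz e heE)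

/-- One of the three moduli at a vertex is the sum of the other two, hence at least 2. -/
lemma HasNZFlow.three_le (h : HasNZFlow G σ r) (hG : IsCubic G) (hV : V(G).Nonempty) :
    3 ≤ r := by
  obtain ⟨τ, -, f, hf, hnz⟩ := h
  obtain ⟨v, hv⟩ := hV
  obtain ⟨a, b, c, -, -, -, h, hsum, hb⟩ := hf.exists_incidenceSet_eq hnz hG hv
  have ha := hb a (by simp [h])
  have hb' := hb b (by simp [h])
  have hc := hb c (by simp [h])
  rw [← abs_unit_mul (τ v a)] at ha
  rw [← abs_unit_mul (τ v b)] at hb'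
  rw [← abs_unit_mul (τ v c)] at hc
  grind

/-- In a nowhere-zero `r`-flow with `r < 4` exactly one of three signed values summing to zero
is large, and its sign is opposite to the sign of the other two. -/
lemma exists_large_of_sum_eq_zero {x y z : ℝ} (hr : r < 4) (h : x + y + z = 0)
    (hx : 1 ≤ |x| ∧ |x| ≤ r - 1) (hy : 1 ≤ |y| ∧ |y| ≤ r - 1) (hz : 1 ≤ |z| ∧ |z| ≤ r - 1) :
    (2 ≤ |x| ∧ ¬ 2 ≤ |y| ∧ ¬ 2 ≤ |z| ∧ (0 < x ∧ y < 0 ∧ z < 0 ∨ x < 0 ∧ 0 < y ∧ 0 < z)) ∨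
    (2 ≤ |y| ∧ ¬ 2 ≤ |x| ∧ ¬ 2 ≤ |z| ∧ (0 < y ∧ x < 0 ∧ z < 0 ∨ y < 0 ∧ 0 < x ∧ 0 < z)) ∨
    (2 ≤ |z| ∧ ¬ 2 ≤ |x| ∧ ¬ 2 ≤ |y| ∧ (0 < z ∧ x < 0 ∧ y < 0 ∨ z < 0 ∧ 0 < x ∧ 0 < y)) := by
  -- The largest modulus is the sum of the other two, which are at least 1; being below 3, it leaves
  -- less than 2 for each.
  rcases abs_cases x with ⟨h1, h1'⟩ | ⟨h1, h1'⟩ <;>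
  rcases abs_cases y with ⟨h2, h2'⟩ | ⟨h2, h2'⟩ <;>
  rcases abs_cases z with ⟨h3, h3'⟩ | ⟨h3, h3'⟩ <;> grind

/-- Large edges of a flow with `r < 4` form a perfect matching, and the sign of every half-edge
times the flow value is determined by a vertex sign and by whether the edge is large. -/
lemma IsFlow.exists_vertex_sign (hf : IsFlow G τ r f) (hnz : ∀ e ∈ E(G), f e ≠ 0)
    (hG : IsCubic G) (hr : r < 4) {v : α} (hv : v ∈ V(G)) :
    (∃! e, e ∈ {e | 2 ≤ |f e|} ∧ G.Inc e v) ∧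
    ∃ s : ℤˣ, ∀ e, G.Inc e v →
      0 < ((s : ℤ) : ℝ) * (((τ v e : ℤ) : ℝ) * f e) * (if 2 ≤ |f e| then 1 else -1) := by
  obtain ⟨a, b, c, hab, hac, hbc, h, hsum, hb⟩ := hf.exists_incidenceSet_eq hnz hG hv
  have hinc : ∀ e, G.Inc e v ↔ e = a ∨ e = b ∨ e = c := fun e ↦ by
    rw [← Graph.mem_incidenceSet, h]; simp
  have key := exists_large_of_sum_eq_zero (r := r) hr hsum
    (by rw [abs_unit_mul]; exact hb a (by simp [h]))
    (by rw [abs_unit_mul]; exact hb b (by simp [h]))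
    (by rw [abs_unit_mul]; exact hb c (by simp [h]))
  simp only [abs_unit_mul] at key
  constructor
  · exact existsUnique_of_incidenceSet_eq h (by simp only [Set.mem_ofPred_eq]; tauto)
  · have : ∃ s : ℤˣ, ∀ e, (e = a ∨ e = b ∨ e = c) →
      0 < ((s : ℤ) : ℝ) * (((τ v e : ℤ) : ℝ) * f e) * (if 2 ≤ |f e| then 1 else -1) := by
      rcases key with ⟨k1, k2, k3, k | k⟩ | ⟨k1, k2, k3, k | k⟩ | ⟨k1, k2, k3, k | k⟩
      all_goals first
        | (refine ⟨1, ?_⟩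
           rintro e (rfl | rfl | rfl) <;> simp only [k1, k2, k3, if_true, if_false] <;>
             push_cast <;> linarith)
        | (refine ⟨-1, ?_⟩
           rintro e (rfl | rfl | rfl) <;> simp only [k1, k2, k3, if_true, if_false] <;>
             push_cast <;> linarith)
    obtain ⟨s, hs⟩ := this
    exact ⟨s, fun e he ↦ hs e ((hinc e).1 he)⟩

lemma HasNZFlow.exists_isPerfectMatching (h : HasNZFlow G σ r) (hG : IsCubic G) (hr : r < 4) :
    ∃ M, IsPerfectMatching G M := by
  obtain ⟨τ, -, f, hf, hnz⟩ := h
  exact ⟨_, fun v hv ↦ (hf.exists_vertex_sign hnz hG hr hv).1⟩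

/-- A cubic signed graph with a nowhere-zero `r`-flow, `r < 4`, is antibalanced. -/
lemma HasNZFlow.exists_switching (h : HasNZFlow G σ r) (hG : IsCubic G) (hr : r < 4) :
    ∃ s : α → ℤˣ, ∀ e u v, G.IsLink e u v → σ e = -(s u * s v) := by
  obtain ⟨τ, hτ, f, hf, hnz⟩ := h
  have : ∀ v, ∃ s : ℤˣ, v ∈ V(G) → ∀ e, G.Inc e v →
      0 < ((s : ℤ) : ℝ) * (((τ v e : ℤ) : ℝ) * f e) * (if 2 ≤ |f e| then 1 else -1) := fun v ↦ by
    by_cases hv : v ∈ V(G)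
    · obtain ⟨s, hs⟩ := (hf.exists_vertex_sign hnz hG hr hv).2
      exact ⟨s, fun _ ↦ hs⟩
    · exact ⟨1, fun h ↦ absurd h hv⟩
  choose s hs using this
  refine ⟨s, fun e u v huv ↦ ?_⟩
  have h1 := hs u huv.left_mem e huv.inc_left
  have h2 := hs v huv.right_mem e huv.inc_right
  have h3 := hτ huv
  have h4 : σ e = -(τ u e * τ v e) := by rw [h3, neg_neg]
  rw [h4]
  -- Both inequalities share `f e` and this factor, so `s u * τ u e` and `s v * τ v e` agree.
  generalize (if 2 ≤ |f e| then (1 : ℝ) else -1) = d at h1 h2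
  rcases Int.units_eq_one_or (s u) with k1 | k1 <;> rcases Int.units_eq_one_or (s v) with k2 | k2 <;>
  rcases Int.units_eq_one_or (τ u e) with k3 | k3 <;>
  rcases Int.units_eq_one_or (τ v e) with k4 | k4 <;> simp only [k1, k2, k3, k4] at h1 h2 ⊢ <;>
  first | rfl | (exfalso; push_cast at h1 h2; linarith)

/-- The number of odd terms is 0 or 2. Three even terms would all be ±2, whose sum is not zero. -/
lemma even_iff_of_sum_eq_zero {x y z : ℤ} (h : x + y + z = 0) (hx : 1 ≤ |x| ∧ |x| < 4)
    (hy : 1 ≤ |y| ∧ |y| < 4) (hz : 1 ≤ |z| ∧ |z| < 4) :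
    (Even x ∧ ¬ Even y ∧ ¬ Even z) ∨ (Even y ∧ ¬ Even x ∧ ¬ Even z) ∨
      (Even z ∧ ¬ Even x ∧ ¬ Even y) := by
  simp only [Int.even_iff]
  grind

/-- Even edges of an integer nowhere-zero flow with `r < 5` form a perfect matching. -/
lemma HasIntNZFlow.exists_isPerfectMatching (h : HasIntNZFlow G σ r) (hG : IsCubic G)
    (hr : r < 5) : ∃ M, IsPerfectMatching G M := by
  obtain ⟨τ, -, f, hf, hnz, hint⟩ := h
  choose! z hz using hint
  refine ⟨{e | Even (z e)}, fun v hv ↦ ?_⟩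
  obtain ⟨a, b, c, hab, hac, hbc, h, hsum, hb⟩ := hf.exists_incidenceSet_eq hnz hG hv
  have hinc : ∀ e, G.Inc e v ↔ e = a ∨ e = b ∨ e = c := fun e ↦ by
    rw [← Graph.mem_incidenceSet, h]; simp
  have hzb : ∀ e, G.Inc e v → 1 ≤ |(τ v e : ℤ) * z e| ∧ |(τ v e : ℤ) * z e| < 4 := fun e he ↦ by
    have h1 := hb e he
    rw [hz e he.edge_mem] at h1
    have h2 : |(τ v e : ℤ) * z e| = |z e| := by
      rcases Int.units_eq_one_or (τ v e) with h | h <;> simp [h]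
    rw [h2]
    refine ⟨by exact_mod_cast h1.1, ?_⟩
    have : ((|z e| : ℤ) : ℝ) < 4 := by push_cast; linarith
    exact_mod_cast this
  have hev : ∀ e, Even ((τ v e : ℤ) * z e) ↔ Even (z e) := fun e ↦ by
    rcases Int.units_eq_one_or (τ v e) with h | h <;> simp [h]
  rw [hz a ((hinc a).2 (by simp)).edge_mem,
    hz b ((hinc b).2 (by simp)).edge_mem, hz c ((hinc c).2 (by simp)).edge_mem] at hsum
  have key := even_iff_of_sum_eq_zero (by exact_mod_cast hsum) (hzb a ((hinc a).2 (by simp)))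
    (hzb b ((hinc b).2 (by simp))) (hzb c ((hinc c).2 (by simp)))
  simp only [hev] at key
  exact existsUnique_of_incidenceSet_eq h key

lemma HasIntNZFlow.hasNZFlow (h : HasIntNZFlow G σ r) : HasNZFlow G σ r := by
  obtain ⟨τ, hτ, f, hf, hnz, -⟩ := h
  exact ⟨τ, hτ, f, hf, hnz⟩

end Flow


/-! ### Edge cuts and components -/

/-- `X` is the set of edges with exactly one end in some vertex set. -/
def IsEdgeCut (G : Graph α β) (X : Set β) : Prop :=
  ∃ S : Set α, ∀ ⦃e u v⦄, G.IsLink e u v → (e ∈ X ↔ ¬ (u ∈ S ↔ v ∈ S))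

lemma IsEdgeCut.empty : IsEdgeCut G ∅ := ⟨∅, by simp⟩

lemma IsEdgeCut.symmDiff {X Y : Set β} (hX : IsEdgeCut G X) (hY : IsEdgeCut G Y) :
    IsEdgeCut G (_root_.symmDiff X Y) := by
  obtain ⟨S, hS⟩ := hX
  obtain ⟨T, hT⟩ := hY
  refine ⟨_root_.symmDiff S T, fun e u v h ↦ ?_⟩
  have h1 := hS h
  have h2 := hT h
  simp only [Set.mem_symmDiff]
  tauto

/-- The vertex set of a cut may be chosen to avoid a given vertex. -/
lemma IsEdgeCut.exists_notMem {X : Set β} (hX : IsEdgeCut G X) (w : α) :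
    ∃ S : Set α, w ∉ S ∧ ∀ ⦃e u v⦄, G.IsLink e u v → (e ∈ X ↔ ¬ (u ∈ S ↔ v ∈ S)) := by
  obtain ⟨S, hS⟩ := hX
  by_cases hw : w ∈ S
  · refine ⟨Sᶜ, by simpa using hw, fun e u v h ↦ ?_⟩
    rw [hS h, Set.mem_compl_iff, Set.mem_compl_iff, not_iff_not, not_iff_not]
  · exact ⟨S, hw, hS⟩

/-- A vertex property that spreads along edges and holds somewhere on a component holds on
the whole component. -/
lemma IsComponent.forall_of_isLink (hC : IsComponent C G) {P : α → Prop} {x : α}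
    (hx : x ∈ V(C)) (hPx : P x) (hP : ∀ e u v, u ∈ V(C) → G.IsLink e u v → P u → P v) :
    ∀ v ∈ V(C), P v := by
  have hcl := hC.prop.1
  -- The vertices of `C` satisfying `P` induce a closed subgraph, which is `C` by minimality.
  set K := G.induce {v | v ∈ V(C) ∧ P v} with hK
  have hKG : K ≤ G := Graph.induce_le fun v hv ↦ hcl.vertexSet_mono hv.1
  have hKc : K ≤c G := by
    refine Graph.IsClosedSubgraph.mk' hKG fun e u ⟨v, huv⟩ hu ↦ ?_
    have hu' : u ∈ V(C) ∧ P u := hu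
    have hv : v ∈ V(C) := ((hcl.isLink_congr hu'.1).2 huv).right_mem
    have : K.IsLink e u v := ⟨huv, hu', hv, hP e u v hu'.1 huv hu'.2⟩
    exact this.edge_mem
  have hKC : K ≤ C := hcl.isInducedSubgraph.le_of_le_subset hKG fun v hv ↦ hv.1
  have hCK : C ≤ K := hC.le_of_le ⟨hKc, x, hx, hPx⟩ hKC
  exact fun v hv ↦ (hCK.vertexSet_mono hv).2

lemma IsComponent.mem_of_isLink (hC : IsComponent C G) {e : β} {u v : α} (hu : u ∈ V(C))
    (h : G.IsLink e u v) : v ∈ V(C) :=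
  ((hC.prop.1.isLink_congr hu).2 h).right_mem

lemma IsComponent.mem_vertexSet (hC : IsComponent C G) {u : α} (hu : u ∈ V(C)) : u ∈ V(G) :=
  hC.prop.1.vertexSet_mono hu

/-! ### Matching edges and cuts -/

/-- Infinite descent: if all matching edges of a component were bridges, the side of such a
bridge could be shrunk forever. -/
lemma IsPerfectMatching.not_isEdgeCut_singleton [G.Loopless] (hV : V(G).Finite)
    (hG : IsCubic G) (hM : IsPerfectMatching G M) (hC : IsComponent C G)
    (hcut : ∀ v ∈ V(C), ∀ m ∈ M, G.Inc m v → IsEdgeCut G {m}) : False := by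
  have key : ∀ n : ℕ, ∀ S : Set α, (S ∩ V(G)).ncard = n → ∀ u ∈ V(C), u ∈ S → ∀ m ∈ M, G.Inc m u →
      ¬ ∀ ⦃e u v⦄, G.IsLink e u v → (e ∈ ({m} : Set β) ↔ ¬ (u ∈ S ↔ v ∈ S)) := by
    intro n
    induction n using Nat.strong_induction_on with
    | _ n ih =>
    intro S hn u hu huS m hmM hmu hS
    obtain ⟨a, b, c, hab, hac, hbc, hinc, haM, hbM, hcM⟩ :=
      hM.exists_incidenceSet_eq hG (hC.mem_vertexSet hu)
    have hbu : G.Inc b u := by rw [← Graph.mem_incidenceSet, hinc]; simp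
    obtain ⟨w, huw⟩ := hbu
    have hw := hC.mem_of_isLink hu huw
    obtain ⟨p, ⟨hpM, w', hww'⟩, -⟩ := hM w (hC.mem_vertexSet hw)
    obtain ⟨u', huu'⟩ := hmu
    -- The edge `b` lies in neither cut, so `w` stays in `S` with `u`, and `u` stays outside `T`
    -- with `w`.
    obtain ⟨T, hwT, hT⟩ := (hcut w hw p hpM hww'.inc_left).exists_notMem w
    have hbm : b ≠ m := fun h ↦ hbM (h ▸ hmM)
    have hbp : b ≠ p := fun h ↦ hbM (h ▸ hpM)
    have hSb := hS huw
    have hTb := hT huw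
    have hSm := hS huu'
    have hTp := hT hww'
    have hSp := hS hww'
    simp only [Set.mem_singleton_iff, hbm, hbp, true_iff, false_iff, not_not] at hSb hTb hSm hTp hSp
    have hwS : w ∈ S := hSb.1 huS
    have huT : u ∉ T := fun h ↦ hwT (hTb.1 h)
    have hu'S : u' ∉ S := fun h ↦ hSm (iff_of_true huS h)
    have hw'T : w' ∈ T := by_contra fun h ↦ hTp (iff_of_false hwT h)
    have hmp : p ≠ m := by
      rintro rfl
      obtain ⟨rfl, -⟩ | ⟨rfl, rfl⟩ := huu'.eq_and_eq_or_eq_and_eq hww'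
      · exact huw.ne rfl
      · exact hu'S hwS
    have hw'S : w' ∈ S := (not_not.1 (mt hSp.2 hmp)).1 hwS
    -- The only edge leaving `S ∩ T` is `p`, and this smaller side has lost `u`.
    refine ih _ ?_ (S ∩ T) rfl w' (hC.mem_of_isLink hw hww') ⟨hw'S, hw'T⟩ p hpM hww'.inc_right ?_
    · rw [← hn]
      refine Set.ncard_lt_ncard ⟨fun x hx ↦ ⟨hx.1.1, hx.2⟩, fun h ↦ ?_⟩ (hV.inter_of_right S)
      exact huT (h ⟨huS, hC.mem_vertexSet hu⟩).1.2
    · intro e y z hyz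
      have h1 := hS hyz
      have h2 := hT hyz
      simp only [Set.mem_singleton_iff, Set.mem_inter_iff] at h1 h2 ⊢
      by_cases hem : e = m
      · subst hem
        obtain ⟨rfl, rfl⟩ | ⟨rfl, rfl⟩ := huu'.eq_and_eq_or_eq_and_eq hyz <;>
          simp [hmp.symm, huT, hu'S]
      · by_cases hep : e = p
        · subst hep
          obtain ⟨rfl, rfl⟩ | ⟨rfl, rfl⟩ := hww'.eq_and_eq_or_eq_and_eq hyz <;>
            simp [hwT, hw'S, hw'T]
        · simp only [hem, hep, false_iff, not_not] at h1 h2 ⊢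
          rw [h1, h2]
  obtain ⟨v, hv⟩ := hC.prop.2
  obtain ⟨m, ⟨hmM, v', hvv'⟩, -⟩ := hM v (hC.mem_vertexSet hv)
  obtain ⟨S, hvS, hS⟩ := (hcut v hv m hmM hvv'.inc_left).exists_notMem v
  have := hS hvv'
  simp only [Set.mem_singleton_iff, true_iff] at this
  exact key _ S rfl v' (hC.mem_of_isLink hv hvv') (by_contra fun h ↦ this (iff_of_false hvS h)) m hmM hvv'.inc_right hS

/-- The matching edges with exactly one end in `{x, y}`. -/
def matchingBoundary (G : Graph α β) (M : Set β) (x y : α) : Set β :=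
  {m ∈ M | ¬ (G.Inc m x ↔ G.Inc m y)}

/-- If a vertex of a component has two distinct neighbours along edges outside the perfect
matching, then for some edge `xy` outside the matching the matching edges leaving `{x, y}` are
not a cut. -/
lemma IsPerfectMatching.exists_not_isEdgeCut [G.Loopless] (hV : V(G).Finite)
    (hG : IsCubic G) (hM : IsPerfectMatching G M) (hC : IsComponent C G) {e₁ e₂ : β} {x y z : α}
    (hy : y ∈ V(C)) (h₁ : G.IsLink e₁ y x) (h₂ : G.IsLink e₂ y z) (h₁M : e₁ ∉ M) (h₂M : e₂ ∉ M)
    (hxz : x ≠ z) :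
    ∃ e u v, G.IsLink e u v ∧ e ∉ M ∧ ¬ IsEdgeCut G (matchingBoundary G M u v) := by
  by_contra! hcut
  have hx := hC.mem_of_isLink hy h₁
  have hz := hC.mem_of_isLink hy h₂
  have huniq : ∀ v ∈ V(C), ∀ m m', m ∈ M → m' ∈ M → G.Inc m v → G.Inc m' v → m = m' :=
    fun v hv m m' hm hm' h h' ↦ (hM v (hC.mem_vertexSet hv)).unique ⟨hm, h⟩ ⟨hm', h'⟩
  have hbd : ∀ u v, u ∈ V(C) → v ∈ V(C) → ∀ m m', m ∈ M → m' ∈ M → G.Inc m u → G.Inc m' v →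
      matchingBoundary G M u v = symmDiff {m} {m'} := by
    intro u v hu hv m m' hm hm' h h'
    ext k
    simp only [matchingBoundary, Set.mem_ofPred_eq, Set.mem_symmDiff, Set.mem_singleton_iff]
    have a1 : k ∈ M → (G.Inc k u ↔ k = m) := fun hk ↦
      ⟨fun hku ↦ huniq u hu k m hk hm hku h, by rintro rfl; exact h⟩
    have a2 : k ∈ M → (G.Inc k v ↔ k = m') := fun hk ↦
      ⟨fun hku ↦ huniq v hv k m' hk hm' hku h', by rintro rfl; exact h'⟩
    by_cases hk : k ∈ M
    · rw [a1 hk, a2 hk]; tauto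
    · have : k ≠ m := by rintro rfl; exact hk hm
      have : k ≠ m' := by rintro rfl; exact hk hm'
      tauto
  -- any two matching edges of the component form a cut
  obtain ⟨mx, ⟨hmxM, x', hmx⟩, -⟩ := hM x (hC.mem_vertexSet hx)
  obtain ⟨my, ⟨hmyM, y', hmy⟩, -⟩ := hM y (hC.mem_vertexSet hy)
  obtain ⟨mz, ⟨hmzM, z', hmz⟩, -⟩ := hM z (hC.mem_vertexSet hz)
  have hpair : ∀ v ∈ V(C), ∀ m ∈ M, G.Inc m v → IsEdgeCut G (symmDiff {mx} {m}) := by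
    refine hC.forall_of_isLink hx (fun m hm hmx' ↦ ?_) fun e u v hu huv hP m hm hmv ↦ ?_
    · rw [huniq x hx m mx hm hmxM hmx' hmx.inc_left, symmDiff_self]
      exact IsEdgeCut.empty
    · have hv := hC.mem_of_isLink hu huv
      obtain ⟨p, ⟨hpM, hpu⟩, -⟩ := hM u (hC.mem_vertexSet hu)
      have h1 := hP p hpM hpu
      by_cases he : e ∈ M
      · rwa [huniq v hv m e hm he hmv huv.inc_right, ← huniq u hu p e hpM he hpu huv.inc_left]
      · have h2 := hcut e u v huv he
        rw [hbd u v hu hv p m hpM hm hpu hmv] at h2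
        have := h1.symmDiff h2
        rwa [symmDiff_assoc, symmDiff_symmDiff_cancel_left] at this
  have hnexy : y ≠ x := h₁.ne
  have hneyz : y ≠ z := h₂.ne
  have hcy := hpair y hy my hmyM hmy.inc_left
  have hcz := hpair z hz mz hmzM hmz.inc_left
  -- Neither `e₁` nor `e₂` lies in these cuts, so `S` and `T` avoid `y` and `z` along with `x`.
  obtain ⟨S, hxS, hS⟩ := hcy.exists_notMem x
  obtain ⟨T, hxT, hT⟩ := hcz.exists_notMem x
  have e1x : e₁ ≠ mx := fun h ↦ h₁M (h ▸ hmxM)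
  have e1y : e₁ ≠ my := fun h ↦ h₁M (h ▸ hmyM)
  have e1z : e₁ ≠ mz := fun h ↦ h₁M (h ▸ hmzM)
  have e2x : e₂ ≠ mx := fun h ↦ h₂M (h ▸ hmxM)
  have e2y : e₂ ≠ my := fun h ↦ h₂M (h ▸ hmyM)
  have e2z : e₂ ≠ mz := fun h ↦ h₂M (h ▸ hmzM)
  simp only [Set.mem_symmDiff, Set.mem_singleton_iff] at hS hT
  have hyS : y ∉ S := by simpa [e1x, e1y, hxS] using hS h₁
  have hyT : y ∉ T := by simpa [e1x, e1z, hxT] using hT h₁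
  have hzS : z ∉ S := by simpa [e2x, e2y, hyS] using hS h₂
  have hzT : z ∉ T := by simpa [e2x, e2z, hyT] using hT h₂
  have nxy : mx ≠ my := by
    rintro rfl
    obtain ⟨rfl, rfl⟩ | ⟨rfl, rfl⟩ := hmx.eq_and_eq_or_eq_and_eq hmy
    · exact hnexy rfl
    · have : mx ≠ mz := by
        rintro rfl
        rcases hmz.left_eq_or_eq hmx with rfl | rfl
        · exact hxz rfl
        · exact hneyz rfl
      simpa [this, hxT, hyT] using hT hmx
  have nyz : my ≠ mz := by
    rintro rfl
    obtain ⟨rfl, rfl⟩ | ⟨rfl, rfl⟩ := hmy.eq_and_eq_or_eq_and_eq hmz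
    · exact hneyz rfl
    · simpa [nxy.symm, hyS, hzS] using hS hmy
  have nxz : mx ≠ mz := by
    rintro rfl
    obtain ⟨rfl, rfl⟩ | ⟨rfl, rfl⟩ := hmx.eq_and_eq_or_eq_and_eq hmz
    · exact hxz rfl
    · simpa [nxy, hxS, hzS] using hS hmx
  have hx'S : x' ∈ S := by simpa [nxy, hxS] using hS hmx
  have hx'T : x' ∈ T := by simpa [nxz, hxT] using hT hmx
  have hy'T : y' ∉ T := by simpa [nxy.symm, nyz, hyT] using hT hmy
  have hz'S : z' ∉ S := by simpa [nxz.symm, nyz.symm, hzS] using hS hmz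
  -- Of the three matching edges only `mx` enters `S ∩ T`: `my` has no end in `S ∩ T` because `y ∉
  -- S` and `y' ∉ T`, and similarly for `mz`.
  have hsing : IsEdgeCut G {mx} := by
    refine ⟨S ∩ T, fun e u v huv ↦ ?_⟩
    have h1 := hS huv
    have h2 := hT huv
    simp only [Set.mem_singleton_iff, Set.mem_inter_iff]
    by_cases hex : e = mx
    · subst hex
      obtain ⟨rfl, rfl⟩ | ⟨rfl, rfl⟩ := hmx.eq_and_eq_or_eq_and_eq huv <;> simp [hxS, hx'S, hx'T]
    by_cases hey : e = my
    · subst hey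
      obtain ⟨rfl, rfl⟩ | ⟨rfl, rfl⟩ := hmy.eq_and_eq_or_eq_and_eq huv <;>
        simp [nxy.symm, hyS, hy'T]
    by_cases hez : e = mz
    · subst hez
      obtain ⟨rfl, rfl⟩ | ⟨rfl, rfl⟩ := hmz.eq_and_eq_or_eq_and_eq huv <;>
        simp [nxz.symm, hzT, hz'S]
    simp only [hex, hey, hez, false_and, or_self, false_iff, not_not] at h1 h2 ⊢
    rw [h1, h2]
  refine hM.not_isEdgeCut_singleton hV hG hC fun v hv m hm hmv ↦ ?_
  have := hsing.symmDiff (hpair v hv m hm hmv)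
  rwa [symmDiff_symmDiff_cancel_left] at this


/-! ### Exchanging the matching -/

/-- If every vertex of a component has a single neighbour outside the matching, exchange the
matching there for one edge of every digon. -/
lemma IsPerfectMatching.exists_distinct_neighbours [G.Loopless] (hG : IsCubic G)
    (hM : IsPerfectMatching G M) (hC : IsComponent C G) (hK : ¬ IsK23 C) :
    ∃ M', IsPerfectMatching G M' ∧ ∃ (e₁ e₂ : β) (x y z : α), y ∈ V(C) ∧ G.IsLink e₁ y x ∧
      G.IsLink e₂ y z ∧ e₁ ∉ M' ∧ e₂ ∉ M' ∧ x ≠ z := by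
  by_cases hdig : ∃ (e₁ e₂ : β) (x y z : α), y ∈ V(C) ∧ G.IsLink e₁ y x ∧
      G.IsLink e₂ y z ∧ e₁ ∉ M ∧ e₂ ∉ M ∧ x ≠ z
  · exact ⟨M, hM, hdig⟩
  push Not at hdig
  -- Indexing by unordered pairs makes both ends of a digon select the same edge; on other pairs the
  -- value is arbitrary.
  have : ∀ s : Sym2 α, ∃ d : β, (∃ e u v, s = s(u, v) ∧ G.IsLink e u v ∧ e ∉ M) →
      d ∉ M ∧ ∃ u v, s = s(u, v) ∧ G.IsLink d u v := fun s ↦ by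
    by_cases h : ∃ e u v, s = s(u, v) ∧ G.IsLink e u v ∧ e ∉ M
    · obtain ⟨e, u, v, hs, huv, he⟩ := h
      exact ⟨e, fun _ ↦ ⟨he, u, v, hs, huv⟩⟩
    · obtain ⟨v, hv⟩ := hC.prop.2
      obtain ⟨e, -⟩ := hM v (hC.mem_vertexSet hv)
      exact ⟨e, fun h' ↦ absurd h' h⟩
  choose d hd using this
  have hd' : ∀ e u v, G.IsLink e u v → e ∉ M → d s(u, v) ∉ M ∧ G.IsLink (d s(u, v)) u v := by
    intro e u v huv he
    obtain ⟨h1, u', v', h2, h3⟩ := hd s(u, v) ⟨e, u, v, rfl, huv, he⟩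
    refine ⟨h1, ?_⟩
    rw [Sym2.eq_iff] at h2
    rcases h2 with ⟨rfl, rfl⟩ | ⟨rfl, rfl⟩
    · exact h3
    · exact h3.symm
  set M' : Set β := {e | (e ∉ M ∧ ∃ u v, u ∈ V(C) ∧ G.IsLink e u v ∧ e = d s(u, v)) ∨
    (e ∈ M ∧ ∃ u, u ∉ V(C) ∧ G.Inc e u)} with hM'
  have hmemC : ∀ {e u}, u ∈ V(C) → G.Inc e u →
      (e ∈ M' ↔ e ∉ M ∧ ∃ v, G.IsLink e u v ∧ e = d s(u, v)) := by
    rintro e u hu ⟨w, huw⟩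
    constructor
    · rintro (⟨he, p, q, hp, hpq, hep⟩ | ⟨he, p, hp, q, hpq⟩)
      · refine ⟨he, w, huw, ?_⟩
        obtain ⟨rfl, rfl⟩ | ⟨rfl, rfl⟩ := hpq.eq_and_eq_or_eq_and_eq huw
        · exact hep
        · rwa [Sym2.eq_swap]
      · obtain ⟨rfl, rfl⟩ | ⟨rfl, rfl⟩ := hpq.eq_and_eq_or_eq_and_eq huw
        · exact absurd hu hp
        · exact absurd (hC.mem_of_isLink hu hpq.symm) hp
    · rintro ⟨he, v, huv, hev⟩
      exact Or.inl ⟨he, u, v, hu, huv, hev⟩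
  refine ⟨M', fun v hv ↦ ?_, ?_⟩
  · by_cases hvC : v ∈ V(C)
    · obtain ⟨a, b, c, hab, hac, hbc, hinc, haM, hbM, hcM⟩ := hM.exists_incidenceSet_eq hG hv
      obtain ⟨p, hvp⟩ : G.Inc b v := by rw [← Graph.mem_incidenceSet, hinc]; simp
      obtain ⟨h1, h2⟩ := hd' b v p hvp hbM
      refine ⟨d s(v, p), ⟨(hmemC hvC h2.inc_left).2 ⟨h1, p, h2, rfl⟩, h2.inc_left⟩, ?_⟩
      rintro e ⟨heM', hev⟩
      obtain ⟨heM, q, hvq, he⟩ := (hmemC hvC hev).1 heM'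
      rw [hdig b e p v q hvC hvp hvq hbM heM]
      exact he
    · obtain ⟨m, ⟨hmM, hmv⟩, hu⟩ := hM v hv
      refine ⟨m, ⟨Or.inr ⟨hmM, v, hvC, hmv⟩, hmv⟩, ?_⟩
      rintro e ⟨⟨he, p, q, hp, hpq, -⟩ | ⟨he, -⟩, hev⟩
      · rcases hev.eq_or_eq_of_isLink hpq with rfl | rfl
        · exact absurd hp hvC
        · exact absurd (hC.mem_of_isLink hp hpq) hvC
      · exact hu e ⟨he, hev⟩
  · obtain ⟨v, hv⟩ := hC.prop.2
    obtain ⟨a, b, c, hab, hac, hbc, hinc, haM, hbM, hcM⟩ :=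
      hM.exists_incidenceSet_eq hG (hC.mem_vertexSet hv)
    have hincv : ∀ e, G.Inc e v ↔ e = a ∨ e = b ∨ e = c := fun e ↦ by
      rw [← Graph.mem_incidenceSet, hinc]; simp
    obtain ⟨q, hvq⟩ : G.Inc a v := by simp [hincv]
    obtain ⟨p, hvp⟩ : G.Inc b v := by simp [hincv]
    obtain ⟨p', hvp'⟩ : G.Inc c v := by simp [hincv]
    obtain rfl := hdig b c p v p' hv hvp hvp' hbM hcM
    -- If `p = q`, the edges `a`, `b`, `c` exhaust the degrees of `v` and `p`, and the component is
    -- `K₂³`.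
    have hpq : p ≠ q := by
      rintro rfl
      refine hK ⟨v, p, hvp.ne, ?_⟩
      have hp := hC.mem_of_isLink hv hvp
      have hincp : G.incidenceSet p = {a, b, c} := by
        refine (Set.eq_of_subset_of_ncard_le ?_ ?_ ?_).symm
        · rintro e (rfl | rfl | rfl)
          exacts [hvq.inc_right, hvp.inc_right, hvp'.inc_right]
        · rw [hG p (hC.mem_vertexSet hp), Set.ncard_eq_three.2 ⟨a, b, c, hab, hac, hbc, rfl⟩]
        · exact Set.finite_of_ncard_ne_zero (by rw [hG p (hC.mem_vertexSet hp)]; decide)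
      have hlink : ∀ e, e = a ∨ e = b ∨ e = c → G.IsLink e v p := by
        rintro e (rfl | rfl | rfl) <;> assumption
      have hVC : ∀ w ∈ V(C), w = v ∨ w = p := by
        refine hC.forall_of_isLink hv (Or.inl rfl) ?_
        rintro e u w - huw hu
        have he : e = a ∨ e = b ∨ e = c := by
          rcases hu with rfl | rfl
          · exact (hincv e).1 huw.inc_left
          · have : e ∈ G.incidenceSet u := huw.inc_left
            rw [hincp] at this
            simpa using this
        exact huw.right_eq_or_eq (hlink e he)
      have hEC : E(C) = {a, b, c} := by
        ext e
        constructor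
        · intro he
          obtain ⟨u, w, huw⟩ := C.exists_isLink_of_mem_edgeSet he
          have huw' : G.IsLink e u w := huw.mono hC.prop.1.le
          rcases hVC u huw.left_mem with rfl | rfl
          · rw [← hinc]; exact huw'.inc_left
          · rw [← hincp]; exact huw'.inc_left
        · intro he
          exact ((hC.prop.1.isLink_congr hv).2 (hlink e he)).edge_mem
      refine ⟨?_, ?_, ?_⟩
      · ext w
        exact ⟨hVC w, by rintro (rfl | rfl) <;> assumption⟩
      · rw [hEC]
        exact Set.ncard_eq_three.2 ⟨a, b, c, hab, hac, hbc, rfl⟩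
      · intro e he
        rw [hEC] at he
        exact (hC.prop.1.isLink_congr hv).2 (hlink e he)
    have haM' : a ∉ M' := fun h ↦ ((hmemC hv hvq.inc_left).1 h).1 haM
    -- At most one of `b`, `c` is in `M'`; the other one and `a` lead to the distinct vertices `p`
    -- and `q`.
    by_cases hb : b ∈ M'
    · obtain ⟨-, w, hvw, hbw⟩ := (hmemC hv hvp.inc_left).1 hb
      obtain rfl := hvp.right_unique hvw
      refine ⟨c, a, p, v, q, hv, hvp', hvq, fun hc ↦ ?_, haM', hpq⟩
      obtain ⟨-, w, hvw', hcw⟩ := (hmemC hv hvp'.inc_left).1 hc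
      obtain rfl := hvp'.right_unique hvw'
      exact hbc (hbw.trans hcw.symm)
    · exact ⟨b, a, p, v, q, hv, hvp, hvq, hb, haM', hpq⟩

/-! ### Explicit flows -/

/-- The all-negative signature of a cubic graph with a perfect matching has a `3`-flow. -/
lemma IsPerfectMatching.hasIntNZFlow_three (hG : IsCubic G) (hM : IsPerfectMatching G M) :
    HasIntNZFlow G (fun _ ↦ -1) 3 := by
  classical
  refine ⟨fun _ e ↦ if e ∈ M then -1 else 1, fun e u v _ ↦ ?_, fun e ↦ if e ∈ M then 2 else 1,
    ⟨fun e _ ↦ Or.inr ?_, fun v hv ↦ ?_⟩, fun e _ ↦ ?_, fun e _ ↦ ?_⟩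
  · beta_reduce
    split_ifs <;> decide
  · beta_reduce
    split_ifs <;> norm_num
  · obtain ⟨a, b, c, hab, hac, hbc, hinc, haM, hbM, hcM⟩ := hM.exists_incidenceSet_eq hG hv
    rw [boundary_eq_of_incidenceSet_eq hab hac hbc hinc]
    simp only [haM, hbM, hcM, if_true, if_false]
    norm_num
  · beta_reduce
    split_ifs <;> norm_num
  · beta_reduce
    split_ifs
    exacts [⟨2, by norm_num⟩, ⟨1, by norm_num⟩]

open Classical in
/-- The half-edge signs of a `4`-flow with value `2` on `M` and `3` on the edge `d = xy`. -/
noncomputable def fourFlowSign (M : Set β) (d : β) (x y v : α) (e : β) : ℤˣ :=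
  if e ∈ M then -1 else if (v = x ∨ v = y) ∧ e ≠ d then -1 else 1

/-- The balance is `3 - 2 - 1` at the ends of `d` and `1 + 1 - 2` elsewhere. -/
lemma IsPerfectMatching.hasIntNZFlow_four {σ : β → ℤˣ} {d : β} {x y : α} (hG : IsCubic G)
    (hM : IsPerfectMatching G M) (hd : G.IsLink d x y) (hdM : d ∉ M)
    (hσ : IsOrientation G σ (fourFlowSign M d x y)) : HasIntNZFlow G σ 4 := by
  classical
  refine ⟨_, hσ, fun e ↦ if e ∈ M then 2 else if e = d then 3 else 1,
    ⟨fun e _ ↦ Or.inr ?_, fun v hv ↦ ?_⟩, fun e _ ↦ ?_, fun e _ ↦ ?_⟩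
  · beta_reduce
    split_ifs <;> norm_num
  · obtain ⟨a, b, c, hab, hac, hbc, hinc, haM, hbM, hcM⟩ := hM.exists_incidenceSet_eq hG hv
    have hincv : ∀ e, G.Inc e v ↔ e = a ∨ e = b ∨ e = c := fun e ↦ by
      rw [← Graph.mem_incidenceSet, hinc]; simp
    rw [boundary_eq_of_incidenceSet_eq hab hac hbc hinc]
    simp only [fourFlowSign, haM, hbM, hcM, if_true, if_false]
    by_cases hvd : v = x ∨ v = y
    · have : G.Inc d v := by
        rcases hvd with rfl | rfl
        exacts [hd.inc_left, hd.inc_right]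
      rcases (hincv d).1 this with rfl | rfl | rfl
      · exact absurd haM hdM
      · simp only [hvd, hbc.symm, ne_eq, not_true_eq_false, not_false_eq_true, and_false, and_true,
          if_true, if_false]
        norm_num
      · simp only [hvd, hbc, ne_eq, not_true_eq_false, not_false_eq_true, and_false, and_true,
          if_true, if_false]
        norm_num
    · have hne : ∀ e, G.Inc e v → e ≠ d := by
        rintro e he rfl
        exact hvd (he.eq_or_eq_of_isLink hd)
      have hb := hne b (by simp [hincv])
      have hc := hne c (by simp [hincv])
      simp only [hvd, hb, hc, false_and, if_false]
      norm_num
  · beta_reduce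
    split_ifs <;> norm_num
  · beta_reduce
    split_ifs
    exacts [⟨2, by norm_num⟩, ⟨3, by norm_num⟩, ⟨1, by norm_num⟩]

/-- If the signature carrying the above `4`-flow also has an `r`-flow with `r < 4`, then the
matching edges leaving `{x, y}` form a cut. -/
lemma HasNZFlow.isEdgeCut_matchingBoundary [G.Loopless] {σ : β → ℤˣ} {d : β} {x y : α} {r : ℝ}
    (h : HasNZFlow G σ r) (hr : r < 4) (hG : IsCubic G) (hd : G.IsLink d x y) (hdM : d ∉ M)
    (hσ : IsOrientation G σ (fourFlowSign M d x y)) :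
    IsEdgeCut G (matchingBoundary G M x y) := by
  classical
  obtain ⟨s, hs⟩ := h.exists_switching hG hr
  -- This is the symmetric difference of `{v | s v = 1}`, whose cut is the set of positive edges,
  -- and `{x, y}`.
  refine ⟨{v | ¬ (s v = 1 ↔ (v = x ∨ v = y))}, fun e u v huv ↦ ?_⟩
  have h1 : fourFlowSign M d x y u e * fourFlowSign M d x y v e = s u * s v := by
    rw [hσ huv, hs e u v huv, neg_neg]
  have hinc : ∀ w, G.Inc e w ↔ w = u ∨ w = v := fun w ↦
    ⟨fun hw ↦ hw.eq_or_eq_of_isLink huv, by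
      rintro (rfl | rfl)
      exacts [huv.inc_left, huv.inc_right]⟩
  have huv' := huv.ne
  have hxy := hd.ne
  have hiff : ((x = u ∨ x = v) ↔ (y = u ∨ y = v)) ↔ ((u = x ∨ u = y) ↔ (v = x ∨ v = y)) := by
    grind
  have hed : e = d → (u = x ∨ u = y) ∧ (v = x ∨ v = y) := by
    rintro rfl
    exact ⟨huv.left_eq_or_eq hd, huv.right_eq_or_eq hd⟩
  simp only [matchingBoundary, Set.mem_ofPred_eq, hinc, hiff]
  simp only [fourFlowSign] at h1
  have hne : (1 : ℤˣ) ≠ -1 := by decide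
  have hne' : (-1 : ℤˣ) ≠ 1 := by decide
  clear hσ hs hinc hiff huv' hxy
  rcases Int.units_eq_one_or (s u) with k1 | k1 <;>
  rcases Int.units_eq_one_or (s v) with k2 | k2 <;>
  by_cases heM : e ∈ M <;> by_cases hA : u = x ∨ u = y <;> by_cases hB : v = x ∨ v = y <;>
  by_cases he : e = d <;> simp only [k1, k2, heM, hA, hB, he] at h1 hed ⊢ <;> simp_all

/-! ### Flow numbers and spectra -/

section Spectrum

variable {σ : β → ℤˣ} {r : ℝ}

lemma circularFlowNumber_eq (h : HasNZFlow G σ r) (hmin : ∀ r', HasNZFlow G σ r' → r ≤ r') :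
    circularFlowNumber G σ = r :=
  le_antisymm (iInf₂_le r h) (le_iInf₂ fun r' h' ↦ EReal.coe_le_coe_iff.2 (hmin r' h'))

lemma integerFlowNumber_eq (h : HasIntNZFlow G σ r)
    (hmin : ∀ r', HasIntNZFlow G σ r' → r ≤ r') : integerFlowNumber G σ = r :=
  le_antisymm (iInf₂_le r h) (le_iInf₂ fun r' h' ↦ EReal.coe_le_coe_iff.2 (hmin r' h'))

/-- Room above the infimum makes it unnecessary to know that it is attained. -/
lemma exists_hasNZFlow_of_circularFlowNumber_eq {b : ℝ} (h : circularFlowNumber G σ = r)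
    (hb : r < b) : ∃ r' < b, HasNZFlow G σ r' := by
  have : circularFlowNumber G σ < b := by rw [h]; exact EReal.coe_lt_coe_iff.2 hb
  simp only [circularFlowNumber, iInf_lt_iff] at this
  obtain ⟨r', h', hlt⟩ := this
  exact ⟨r', EReal.coe_lt_coe_iff.1 hlt, h'⟩

lemma exists_hasIntNZFlow_of_integerFlowNumber_eq {b : ℝ} (h : integerFlowNumber G σ = r)
    (hb : r < b) : ∃ r' < b, HasIntNZFlow G σ r' := by
  have : integerFlowNumber G σ < b := by rw [h]; exact EReal.coe_lt_coe_iff.2 hb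
  simp only [integerFlowNumber, iInf_lt_iff] at this
  obtain ⟨r', h', hlt⟩ := this
  exact ⟨r', EReal.coe_lt_coe_iff.1 hlt, h'⟩

lemma HasNZFlow.mem_admissibleSignatures (h : HasNZFlow G σ r) (hr : 2 ≤ r) :
    σ ∈ admissibleSignatures G E(G) :=
  ⟨⟨r, hr, h⟩, fun _ he ↦ he.1⟩

end Spectrum

lemma IsPerfectMatching.four_mem_intFlowSpectrum [G.Loopless] (hV : V(G).Finite)
    (hG : IsCubic G) (hM : IsPerfectMatching G M) (hC : IsComponent C G) (hK : ¬ IsK23 C) :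
    (4 : ℝ) ∈ intFlowSpectrum G := by
  obtain ⟨M', hM', e₁, e₂, x, y, z, hy, h₁, h₂, h₁M, h₂M, hxz⟩ :=
    hM.exists_distinct_neighbours hG hC hK
  obtain ⟨d, u, v, hd, hdM, hcut⟩ := hM'.exists_not_isEdgeCut hV hG hC hy h₁ h₂ h₁M h₂M hxz
  obtain ⟨σ, hσ⟩ := exists_isOrientation G (fourFlowSign M' d u v)
  have hflow := hM'.hasIntNZFlow_four hG hd hdM hσ
  refine ⟨σ, hflow.hasNZFlow.mem_admissibleSignatures (by norm_num),
    integerFlowNumber_eq hflow fun r hr ↦ not_lt.1 fun hlt ↦ ?_⟩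
  exact hcut (hr.hasNZFlow.isEdgeCut_matchingBoundary hlt hG hd hdM hσ)

end SignedFlow

theorem theorem5p6 {α β : Type*} (G : Graph α β) [G.Loopless]
    (hV : V(G).Finite) (hE : E(G).Finite) (hcubic : SignedFlow.IsCubic G)
    (hK : ∃ C : Graph α β, SignedFlow.IsComponent C G ∧ ¬ SignedFlow.IsK23 C) :
    List.TFAE [
      SignedFlow.HasOneFactor G,
      (3 : ℝ) ∈ SignedFlow.flowSpectrum G,
      (3 : ℝ) ∈ SignedFlow.intFlowSpectrum G,
      (4 : ℝ) ∈ SignedFlow.intFlowSpectrum G] := by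
  open SignedFlow in
  obtain ⟨C, hC, hCK⟩ := hK
  have hne : V(G).Nonempty := hC.prop.2.mono hC.prop.1.vertexSet_mono
  tfae_have 1 → 2 := fun h ↦ by
    obtain ⟨M, hM⟩ := h.exists_isPerfectMatching
    have hf := (hM.hasIntNZFlow_three hcubic).hasNZFlow
    exact ⟨_, hf.mem_admissibleSignatures (by norm_num),
      circularFlowNumber_eq hf fun r hr ↦ hr.three_le hcubic hne⟩
  tfae_have 1 → 3 := fun h ↦ by
    obtain ⟨M, hM⟩ := h.exists_isPerfectMatching
    have hf := hM.hasIntNZFlow_three hcubic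
    exact ⟨_, hf.hasNZFlow.mem_admissibleSignatures (by norm_num),
      integerFlowNumber_eq hf fun r hr ↦ hr.hasNZFlow.three_le hcubic hne⟩
  tfae_have 1 → 4 := fun h ↦ by
    obtain ⟨M, hM⟩ := h.exists_isPerfectMatching
    exact hM.four_mem_intFlowSpectrum hV hcubic hC hCK
  tfae_have 2 → 1 := fun ⟨σ, _, hσ⟩ ↦ by
    obtain ⟨r, hr, h⟩ := exists_hasNZFlow_of_circularFlowNumber_eq hσ (b := 4) (by norm_num)
    obtain ⟨M, hM⟩ := h.exists_isPerfectMatching hcubic hr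
    exact hasOneFactor_of_isPerfectMatching hM
  tfae_have 3 → 1 := fun ⟨σ, _, hσ⟩ ↦ by
    obtain ⟨r, hr, h⟩ := exists_hasIntNZFlow_of_integerFlowNumber_eq hσ (b := 5) (by norm_num)
    obtain ⟨M, hM⟩ := h.exists_isPerfectMatching hcubic hr
    exact hasOneFactor_of_isPerfectMatching hM
  tfae_have 4 → 1 := fun ⟨σ, _, hσ⟩ ↦ by
    -- The parity argument allows every `r < 5`, since integer values then still have modulus at
    -- most 3.
    obtain ⟨r, hr, h⟩ := exists_hasIntNZFlow_of_integerFlowNumber_eq hσ (b := 5) (by norm_num)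
    obtain ⟨M, hM⟩ := h.exists_isPerfectMatching hcubic hr
    exact hasOneFactor_of_isPerfectMatching hM
  tfae_finish
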